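/- Let $K$ be a field and let $n\ge 2$ and $d\ge 1$ be integers. Let $L_K(n)$ be the Leavitt $K$-algebra, i.e. the unital associative $K$-algebra with generators $x_1,\dots,x_n,y_1,\dots,y_n$ and relations $y_ix_j=\delta_{ij}1$ for all $1\le i,j\le n$ and $\sum_{i=1}^n x_iy_i=1$, and let $\mathbb{M}_d(L_K(n))$ be the algebra of $d\times d$ matrices over it. For an associative $K$-algebra $R$ let $[R,R]$ be the $K$-subspace of $R$ spanned by all commutators $[a,b]=ab-ba$ with $a,b\in R$, regarded as a Lie $K$-algebra with the commutator bracket. A Lie $K$-algebra $L$ is called simple if $[L,L]\neq 0$ and its only Lie ideals ($K$-subspaces $I$ with $[L,I]\subseteq I$) are $0$ and $L$. Then the Lie $K$-algebra $$[\mathbb{M}_d(L_K(n)),\mathbb{M}_d(L_K(n))]$$ is simple if and only if $\mathrm{char}(K)$ divides $n-1$ and $\mathrm{char}(K)$ does not divide $d$. (In particular, it is never simple when $\mathrm{char}(K)=0$, as $0$ divides no nonzero integer.) -/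

import Mathlib

/-- The generators of the Leavitt algebra of type `(1, n)`: `x i` and `y i` for `i < n`. -/
inductive LeavittGen (n : ℕ) : Type
  | x (i : Fin n) : LeavittGen n
  | y (i : Fin n) : LeavittGen n

/-- The defining relations `y i * x j = δ i j` and `∑ i, x i * y i = 1`. -/
inductive LeavittRel (K : Type*) [Field K] (n : ℕ) :
    FreeAlgebra K (LeavittGen n) → FreeAlgebra K (LeavittGen n) → Prop
  | y_mul_x (i j : Fin n) : LeavittRel K n
      (FreeAlgebra.ι K (LeavittGen.y i) * FreeAlgebra.ι K (LeavittGen.x j))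
      (if i = j then 1 else 0)
  | sum_x_mul_y : LeavittRel K n
      (∑ i : Fin n, FreeAlgebra.ι K (LeavittGen.x i) * FreeAlgebra.ι K (LeavittGen.y i)) 1

/-- The classical Leavitt algebra `L_K(n)`: the unital associative `K`-algebra presented by
`x i`, `y i` (`i < n`) subject to `y i * x j = δ i j` and `∑ i, x i * y i = 1`. -/
def LeavittAlgebra (K : Type*) [Field K] (n : ℕ) : Type _ :=
  RingQuot (LeavittRel K n)

noncomputable instance LeavittAlgebra.instRing (K : Type*) [Field K] (n : ℕ) :
    Ring (LeavittAlgebra K n) :=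
  inferInstanceAs (Ring (RingQuot (LeavittRel K n)))

noncomputable instance LeavittAlgebra.instAlgebra (K : Type*) [Field K] (n : ℕ) :
    Algebra K (LeavittAlgebra K n) :=
  inferInstanceAs (Algebra K (RingQuot (LeavittRel K n)))

-- An associative algebra is a Lie algebra under `⁅a, b⁆ = a * b - b * a`.
attribute [local instance 100] LieRing.ofAssociativeRing

/-- The Lie `K`-algebra `[A, A]` associated to an associative `K`-algebra `A`: the span of all
commutators `a * b - b * a`, with the commutator bracket. -/
def commutatorLieAlgebra (K A : Type*) [Field K] [Ring A] [Algebra K A] : LieSubalgebra K A where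
  toSubmodule := Submodule.span K {c : A | ∃ a b : A, c = a * b - b * a}
  lie_mem' := fun {a b} _ _ =>
    Submodule.subset_span ⟨a, b, LieRing.of_associative_ring_bracket a b⟩

/-! Write `L` for the Leavitt algebra and `A` for the matrix algebra. If `1` lies in `[A, A]`, the
scalars form a central Lie ideal, and simplicity fails. This happens when `n ≠ 1` in `K`, because `∑
[x i, y i] = 1 - n`, and when `d = 0` in `K`, because `∑ i, [e_ij, e_ji] = 1 - d • e_jj`.

Conversely, let `n = 1` and `d ≠ 0` in `K`. Since `L ≃ M_n(L)`, the size `d` may be replaced by `d *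
n ^ 2 ≥ 3`. A space of matrices stable under brackets with off-diagonal elementary matrices then
either has a nonzero off-diagonal entry somewhere, and so contains `[A, A]`, or consists of scalar
matrices (`Matrix.eq_bot_or_commutatorLieAlgebra_le`). This uses that nonzero elements of `L` can be
carried to `1` (`exists_mul_mul_eq_one`) and that the centre of `L` is `K`.

It remains to keep nonzero scalars out of `[A, A]`, for which a trace on `L` with value `1` at `1`
suffices. Let `L` act on the space of finite words by adding and deleting first letters, modulo
finite rank, and sum the diagonal coefficients over the words of length `k`. Swapping a generator
past an operator only shifts `k` by one, and for `n = 1` in `K` these sums are eventually constant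
in `k`, so the limiting value is a trace (`trace_mul_comm`). -/

namespace LeavittAlgebra

/-! ### Generators and universal property. -/

section Generators

variable (K : Type*) [Field K] {n : ℕ}

/-- The generator `x i` of the Leavitt algebra. -/
noncomputable def x (i : Fin n) : LeavittAlgebra K n :=
  RingQuot.mkAlgHom K (LeavittRel K n) (FreeAlgebra.ι K (LeavittGen.x i))

/-- The generator `y i` of the Leavitt algebra. -/
noncomputable def y (i : Fin n) : LeavittAlgebra K n :=
  RingQuot.mkAlgHom K (LeavittRel K n) (FreeAlgebra.ι K (LeavittGen.y i))

theorem y_mul_x (i j : Fin n) : y K i * x K j = if i = j then 1 else 0 := by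
  have h := RingQuot.mkAlgHom_rel K (LeavittRel.y_mul_x (K := K) i j)
  rw [map_mul, apply_ite (RingQuot.mkAlgHom K (LeavittRel K n)), map_one, map_zero] at h
  exact h

theorem y_mul_x_self (i : Fin n) : y K i * x K i = 1 := by simp [y_mul_x]

theorem sum_x_mul_y : ∑ i : Fin n, x K i * y K i = 1 := by
  have h := RingQuot.mkAlgHom_rel K (LeavittRel.sum_x_mul_y (K := K) (n := n))
  rw [map_sum, map_one] at h
  simp only [map_mul] at h
  exact h

/-- A property of elements of the Leavitt algebra holds everywhere if it holds for scalars and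
generators and is stable under sums and products. -/
theorem induction_on {P : LeavittAlgebra K n → Prop}
    (algebraMap : ∀ c : K, P (algebraMap K _ c)) (x : ∀ i, P (x K i)) (y : ∀ i, P (y K i))
    (mul : ∀ a b, P a → P b → P (a * b)) (add : ∀ a b, P a → P b → P (a + b))
    (a : LeavittAlgebra K n) : P a := by
  obtain ⟨a, rfl⟩ := RingQuot.mkAlgHom_surjective K (LeavittRel K n) a
  induction a using FreeAlgebra.induction with
  | grade0 c => rw [AlgHom.commutes]; exact algebraMap c
  | grade1 g =>
    cases g with
    | x i => exact x i
    | y i => exact y i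
  | mul a b ha hb => rw [map_mul]; exact mul _ _ ha hb
  | add a b ha hb => rw [map_add]; exact add _ _ ha hb

variable {A : Type*} [Ring A] [Algebra K A] {a b : Fin n → A}

theorem freeAlgebra_lift_eq_of_rel (hba : ∀ i j, b i * a j = if i = j then 1 else 0)
    (hab : ∑ i, a i * b i = 1) ⦃u v : FreeAlgebra K (LeavittGen n)⦄ (h : LeavittRel K n u v) :
    FreeAlgebra.lift K (fun g => (LeavittGen.casesOn g a b : A)) u =
      FreeAlgebra.lift K (fun g => (LeavittGen.casesOn g a b : A)) v := by
  cases h with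
  | y_mul_x i j =>
    rw [map_mul, FreeAlgebra.lift_ι_apply, FreeAlgebra.lift_ι_apply,
      apply_ite (FreeAlgebra.lift K _), map_one, map_zero]
    exact hba i j
  | sum_x_mul_y =>
    rw [map_sum, map_one]
    simp only [map_mul, FreeAlgebra.lift_ι_apply]
    exact hab

/-- The universal property of the Leavitt algebra. -/
noncomputable def lift (hba : ∀ i j, b i * a j = if i = j then 1 else 0)
    (hab : ∑ i, a i * b i = 1) : LeavittAlgebra K n →ₐ[K] A :=
  RingQuot.liftAlgHom K ⟨_, freeAlgebra_lift_eq_of_rel K hba hab⟩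

theorem lift_x (hba : ∀ i j, b i * a j = if i = j then 1 else 0) (hab : ∑ i, a i * b i = 1)
    (i : Fin n) : lift K hba hab (x K i) = a i :=
  (RingQuot.liftAlgHom_mkAlgHom_apply K _ (freeAlgebra_lift_eq_of_rel K hba hab) _).trans
    (FreeAlgebra.lift_ι_apply _ _)

theorem lift_y (hba : ∀ i j, b i * a j = if i = j then 1 else 0) (hab : ∑ i, a i * b i = 1)
    (i : Fin n) : lift K hba hab (y K i) = b i :=
  (RingQuot.liftAlgHom_mkAlgHom_apply K _ (freeAlgebra_lift_eq_of_rel K hba hab) _).trans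
    (FreeAlgebra.lift_ι_apply _ _)

end Generators

/-! ### Monomials and the spanning set. -/

section Words

variable (K : Type*) [Field K] {n : ℕ}

/-- The monomial `x i₁ * ⋯ * x iₖ` attached to the word `[i₁, …, iₖ]`. -/
noncomputable def xWord (w : List (Fin n)) : LeavittAlgebra K n := (w.map (x K)).prod

/-- The monomial `y iₖ * ⋯ * y i₁` attached to the word `[i₁, …, iₖ]`. -/
noncomputable def yWord (w : List (Fin n)) : LeavittAlgebra K n := (w.reverse.map (y K)).prod

@[simp] theorem xWord_nil : xWord K ([] : List (Fin n)) = 1 := rfl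

@[simp] theorem yWord_nil : yWord K ([] : List (Fin n)) = 1 := rfl

theorem xWord_cons (i : Fin n) (w) : xWord K (i :: w) = x K i * xWord K w := by
  simp [xWord]

theorem yWord_cons (i : Fin n) (w) : yWord K (i :: w) = yWord K w * y K i := by
  simp [yWord]

theorem xWord_append (u v : List (Fin n)) : xWord K (u ++ v) = xWord K u * xWord K v := by
  simp [xWord]

theorem yWord_concat (w) (i : Fin n) : yWord K (w ++ [i]) = y K i * yWord K w := by
  simp [yWord]

theorem yWord_cons_mul_xWord_cons (i j : Fin n) (u v) :
    yWord K (i :: u) * xWord K (j :: v) = if i = j then yWord K u * xWord K v else 0 := by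
  rw [yWord_cons, xWord_cons, mul_assoc, ← mul_assoc (y K i), y_mul_x]
  split_ifs <;> simp

theorem yWord_mul_xWord_self (w : List (Fin n)) : yWord K w * xWord K w = 1 := by
  induction w with
  | nil => simp
  | cons i w ih => rw [yWord_cons_mul_xWord_cons, if_pos rfl, ih]

/-- Letters cancel in pairs until one word is exhausted or a mismatch gives zero, so the outcome
depends on which word is a prefix of the other. -/
theorem yWord_mul_xWord_eq_or (u v : List (Fin n)) :
    yWord K u * xWord K v = 0 ∨ (∃ w, yWord K u * xWord K v = xWord K w ∧ v = u ++ w) ∨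
      ∃ w, yWord K u * xWord K v = yWord K w ∧ u = v ++ w := by
  induction u generalizing v with
  | nil => exact Or.inr (Or.inl ⟨v, by simp, rfl⟩)
  | cons i u ih =>
    cases v with
    | nil => exact Or.inr (Or.inr ⟨i :: u, by simp, rfl⟩)
    | cons j v =>
      rw [yWord_cons_mul_xWord_cons]
      split_ifs with h
      · subst h
        rcases ih v with h | ⟨w, h, rfl⟩ | ⟨w, h, rfl⟩
        · exact Or.inl h
        · exact Or.inr (Or.inl ⟨w, h, rfl⟩)
        · exact Or.inr (Or.inr ⟨w, h, rfl⟩)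
      · exact Or.inl rfl

/-- The Leavitt algebra is spanned by the monomials `xWord u * yWord v`. -/
theorem span_monomials_eq_top :
    Submodule.span K (Set.range fun p : List (Fin n) × List (Fin n) =>
      xWord K p.1 * yWord K p.2) = ⊤ := by
  set M := Submodule.span K (Set.range fun p : List (Fin n) × List (Fin n) =>
      xWord K p.1 * yWord K p.2) with hM
  -- The span is a left ideal containing `1`; it is enough to multiply by generators.
  have key : ∀ a : LeavittAlgebra K n, ∀ m ∈ M, a * m ∈ M := by
    intro a
    induction a using induction_on with
    | algebraMap c => intro m hm; rw [← Algebra.smul_def]; exact M.smul_mem c hm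
    | x i =>
      intro m hm
      induction hm using Submodule.span_induction with
      | mem m hm =>
        obtain ⟨p, rfl⟩ := hm
        exact Submodule.subset_span ⟨(i :: p.1, p.2), by simp [xWord_cons, mul_assoc]⟩
      | zero => simp
      | add u v _ _ hu hv => rw [mul_add]; exact M.add_mem hu hv
      | smul c u _ hu => rw [mul_smul_comm]; exact M.smul_mem c hu
    | y i =>
      intro m hm
      induction hm using Submodule.span_induction with
      | mem m hm =>
        obtain ⟨⟨u, v⟩, rfl⟩ := hm
        cases u with
        | nil => exact Submodule.subset_span ⟨([], v ++ [i]), by simp [yWord_concat]⟩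
        | cons j u =>
          simp only [xWord_cons, ← mul_assoc, y_mul_x]
          split_ifs
          · exact Submodule.subset_span ⟨(u, v), by simp⟩
          · simp
      | zero => simp
      | add u v _ _ hu hv => rw [mul_add]; exact M.add_mem hu hv
      | smul c u _ hu => rw [mul_smul_comm]; exact M.smul_mem c hu
    | mul a b ha hb => intro m hm; rw [mul_assoc]; exact ha _ (hb _ hm)
    | add a b ha hb => intro m hm; rw [add_mul]; exact M.add_mem (ha _ hm) (hb _ hm)
  rw [eq_top_iff]
  intro a _
  have := key a 1 (Submodule.subset_span ⟨([], []), by simp⟩)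
  rwa [mul_one] at this

end Words

/-! ### Compression by words without self-overlap. -/

section Probe

variable (K : Type*) [Field K] {n : ℕ} (i j : Fin n)

/-- The word `i ⋯ i j` with `N` letters `i`. -/
def probe (N : ℕ) : List (Fin n) := List.replicate N i ++ [j]

variable {i j}

theorem probe_succ (N : ℕ) : probe i j (N + 1) = i :: probe i j N := rfl

/-- The bound on the length keeps `w` inside the block of letters `i`: either `w` is a power of `i`,
which shortens the block, or a mismatch occurs. -/
theorem yWord_probe_mul_xWord {N : ℕ} {w : List (Fin n)} (hw : w.length ≤ N) :
    yWord K (probe i j N) * xWord K w = 0 ∨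
      yWord K (probe i j N) * xWord K w = yWord K (probe i j (N - w.length)) := by
  induction w generalizing N with
  | nil => simp
  | cons k w ih =>
    obtain ⟨N, rfl⟩ : ∃ M, N = M + 1 := ⟨N - 1, by simp at hw; omega⟩
    rw [probe_succ, yWord_cons_mul_xWord_cons]
    split_ifs
    · simpa using ih (N := N) (by simpa using hw)
    · simp

theorem yWord_mul_xWord_probe {N : ℕ} {w : List (Fin n)} (hw : w.length ≤ N) :
    yWord K w * xWord K (probe i j N) = 0 ∨
      yWord K w * xWord K (probe i j N) = xWord K (probe i j (N - w.length)) := by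
  induction w generalizing N with
  | nil => simp
  | cons k w ih =>
    obtain ⟨N, rfl⟩ : ∃ M, N = M + 1 := ⟨N - 1, by simp at hw; omega⟩
    rw [probe_succ, yWord_cons_mul_xWord_cons]
    split_ifs
    · simpa using ih (N := N) (by simpa using hw)
    · simp

/-- The final `j` marks the end of the block, so neither of two distinct probes is a prefix of the
other. -/
theorem yWord_probe_mul_xWord_probe_of_ne (hij : i ≠ j) {N M : ℕ} (h : N ≠ M) :
    yWord K (probe i j N) * xWord K (probe i j M) = 0 := by
  induction N generalizing M with
  | zero =>
    obtain ⟨M, rfl⟩ : ∃ M', M = M' + 1 := ⟨M - 1, by omega⟩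
    rw [probe_succ, show probe i j 0 = j :: [] from rfl, yWord_cons_mul_xWord_cons,
      if_neg hij.symm]
  | succ N ih =>
    cases M with
    | zero =>
      rw [probe_succ, show probe i j 0 = j :: [] from rfl, yWord_cons_mul_xWord_cons, if_neg hij]
    | succ M =>
      rw [probe_succ, probe_succ, yWord_cons_mul_xWord_cons, if_pos rfl]
      exact ih (by omega)

/-- Compressing an element by a sufficiently long probe word gives a scalar. -/
theorem exists_forall_compress_mem_range (hij : i ≠ j) (a : LeavittAlgebra K n) :
    ∃ N₀, ∀ N ≥ N₀, yWord K (probe i j N) * a * xWord K (probe i j N) ∈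
      (⊥ : Subalgebra K (LeavittAlgebra K n)) := by
  have ha : a ∈ Submodule.span K (Set.range fun p : List (Fin n) × List (Fin n) =>
      xWord K p.1 * yWord K p.2) := by rw [span_monomials_eq_top]; trivial
  induction ha using Submodule.span_induction with
  | mem a ha =>
    obtain ⟨⟨u, v⟩, rfl⟩ := ha
    refine ⟨u.length + v.length, fun N hN => ?_⟩
    dsimp only
    rw [mul_assoc, mul_assoc, ← mul_assoc]
    rcases yWord_probe_mul_xWord K (i := i) (j := j) (N := N) (w := u) (by omega) with h | h
    · simp [h]
    rcases yWord_mul_xWord_probe K (i := i) (j := j) (N := N) (w := v) (by omega) with h' | h'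
    · simp [h']
    rw [h, h']
    by_cases huv : N - u.length = N - v.length
    · rw [huv, yWord_mul_xWord_self]; exact one_mem _
    · rw [yWord_probe_mul_xWord_probe_of_ne K hij huv]; exact zero_mem _
  | zero => exact ⟨0, by simp⟩
  | add a b _ _ ha hb =>
    obtain ⟨N, hN⟩ := ha
    obtain ⟨M, hM⟩ := hb
    refine ⟨N + M, fun k hk => ?_⟩
    rw [mul_add, add_mul]
    exact add_mem (hN k (by omega)) (hM k (by omega))
  | smul c a _ ha =>
    obtain ⟨N, hN⟩ := ha
    refine ⟨N, fun k hk => ?_⟩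
    rw [mul_smul_comm, smul_mul_assoc]
    exact Subalgebra.smul_mem _ (hN k hk) c

theorem compress_xWord_eq_zero (hij : i ≠ j) {N : ℕ} {w : List (Fin n)} (hw : w ≠ [])
    (hN : w.length ≤ N) :
    yWord K (probe i j N) * xWord K w * xWord K (probe i j N) = 0 := by
  have : 0 < w.length := List.length_pos_iff.2 hw
  rcases yWord_probe_mul_xWord K (i := i) (j := j) hN with h | h
  · simp [h]
  · rw [h, yWord_probe_mul_xWord_probe_of_ne K hij (by omega)]

end Probe

/-! ### Centre and simplicity of the Leavitt algebra. -/

section Simplicity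

variable {K : Type*} [Field K] {n : ℕ}

/-- The centre of the Leavitt algebra consists of the scalars. -/
theorem exists_algebraMap_eq_of_forall_commute (hn : 2 ≤ n) {c : LeavittAlgebra K n}
    (hc : ∀ a, c * a = a * c) : ∃ k : K, algebraMap K _ k = c := by
  have hij : (⟨0, by omega⟩ : Fin n) ≠ ⟨1, by omega⟩ := by simp
  obtain ⟨N, hN⟩ := exists_forall_compress_mem_range K hij c
  have h := hN N le_rfl
  -- A central element equals its own compression.
  rw [mul_assoc, hc, ← mul_assoc, yWord_mul_xWord_self, one_mul] at h
  exact Algebra.mem_bot.1 h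

/-- A long enough word on the right absorbs every `y` occurring in `a`. -/
theorem exists_mul_xWord_eq_sum (a : LeavittAlgebra K n) :
    ∃ N, ∀ w : List (Fin n), N ≤ w.length →
      a * xWord K w ∈ Submodule.span K (Set.range (xWord K : List (Fin n) → _)) := by
  have ha : a ∈ Submodule.span K (Set.range fun p : List (Fin n) × List (Fin n) =>
      xWord K p.1 * yWord K p.2) := by rw [span_monomials_eq_top]; trivial
  induction ha using Submodule.span_induction with
  | mem a ha =>
    obtain ⟨⟨u, v⟩, rfl⟩ := ha
    refine ⟨v.length, fun w hw => ?_⟩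
    dsimp only
    rw [mul_assoc]
    rcases yWord_mul_xWord_eq_or K v w with h | ⟨t, h, -⟩ | ⟨t, h, rfl⟩
    · simp [h]
    · rw [h, ← xWord_append]; exact Submodule.subset_span ⟨_, rfl⟩
    · obtain rfl : t = [] := by
        rw [List.length_append] at hw
        exact List.length_eq_zero_iff.1 (by omega)
      rw [h, yWord_nil, mul_one]; exact Submodule.subset_span ⟨_, rfl⟩
  | zero => exact ⟨0, by simp⟩
  | add a b _ _ ha hb =>
    obtain ⟨N, hN⟩ := ha
    obtain ⟨M, hM⟩ := hb
    refine ⟨N + M, fun w hw => ?_⟩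
    rw [add_mul]
    exact add_mem (hN w (by omega)) (hM w (by omega))
  | smul c a _ ha =>
    obtain ⟨N, hN⟩ := ha
    refine ⟨N, fun w hw => ?_⟩
    rw [smul_mul_assoc]
    exact Submodule.smul_mem _ c (hN w hw)

/-- By `∑ x i * y i = 1`, an element killed on the right by every `x i` is zero. -/
theorem exists_mul_xWord_ne_zero {a : LeavittAlgebra K n} (ha : a ≠ 0) (N : ℕ) :
    ∃ w : List (Fin n), w.length = N ∧ a * xWord K w ≠ 0 := by
  induction N with
  | zero => exact ⟨[], rfl, by simpa using ha⟩
  | succ N ih =>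
    obtain ⟨w, hw, h⟩ := ih
    by_contra! hcon
    apply h
    rw [← mul_one (xWord K w), ← sum_x_mul_y, ← mul_assoc, Finset.mul_sum]
    refine Finset.sum_eq_zero fun i _ => ?_
    have := hcon (w ++ [i]) (by simp [hw])
    rw [xWord_append] at this
    rw [← mul_assoc, mul_assoc a]
    simp only [xWord_cons, xWord_nil, mul_one] at this
    rw [this, zero_mul]

/-- Every nonzero element of the Leavitt algebra can be carried to `1` by multiplications on
both sides; in particular the Leavitt algebra is a simple ring. -/
theorem exists_mul_mul_eq_one (hn : 2 ≤ n) {s : LeavittAlgebra K n} (hs : s ≠ 0) :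
    ∃ a b, a * s * b = 1 := by
  have hij : (⟨0, by omega⟩ : Fin n) ≠ ⟨1, by omega⟩ := by simp
  obtain ⟨N, hN⟩ := exists_mul_xWord_eq_sum s
  obtain ⟨w, hw, hsw⟩ := exists_mul_xWord_ne_zero hs N
  obtain ⟨f, hf⟩ := Finsupp.mem_span_range_iff_exists_finsupp.1 (hN w hw.ge)
  have hf0 : f.support.Nonempty := by
    rw [Finset.nonempty_iff_ne_empty, Ne, Finsupp.support_eq_empty]
    rintro rfl
    exact hsw (by rw [← hf]; simp)
  -- With `u` of minimal length, `yWord K u` turns each other term into zero or a multiple of a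
  -- monomial `xWord K t` with `t` nonempty. Compression by a probe longer than all words involved
  -- kills the latter and leaves the scalar `f u`.
  obtain ⟨u, hu, hmin⟩ := f.support.exists_min_image List.length hf0
  set M := ∑ v ∈ f.support, v.length with hM
  set V := probe (⟨0, by omega⟩ : Fin n) ⟨1, by omega⟩ M with hV
  have key : yWord K V * (yWord K u * (s * xWord K w)) * xWord K V = algebraMap K _ (f u) := by
    rw [← hf, Finsupp.sum, Finset.mul_sum, Finset.mul_sum, Finset.sum_mul,
      Finset.sum_eq_single_of_mem u hu]
    · rw [mul_smul_comm, yWord_mul_xWord_self, mul_smul_comm, mul_one, smul_mul_assoc,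
        yWord_mul_xWord_self, Algebra.algebraMap_eq_smul_one]
    · intro v hv hvu
      rw [mul_smul_comm, mul_smul_comm, smul_mul_assoc]
      have hle : v.length ≤ M := Finset.single_le_sum (f := List.length) (by simp) hv
      have hmin' := hmin v hv
      rcases yWord_mul_xWord_eq_or K u v with h | ⟨t, h, rfl⟩ | ⟨t, h, rfl⟩
      · simp [h]
      · rw [h, compress_xWord_eq_zero K hij (by rintro rfl; simp at hvu), smul_zero]
        rw [List.length_append] at hle; omega
      · obtain rfl : t = [] := by
          rw [List.length_append] at hmin'
          exact List.length_eq_zero_iff.1 (by omega)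
        simp at hvu
  have hfu : f u ≠ 0 := Finsupp.mem_support_iff.1 hu
  refine ⟨algebraMap K _ (f u)⁻¹ * (yWord K V * yWord K u), xWord K w * xWord K V, ?_⟩
  have : algebraMap K (LeavittAlgebra K n) (f u)⁻¹ * algebraMap K _ (f u) = 1 := by
    rw [← map_mul, inv_mul_cancel₀ hfu, map_one]
  rw [← this, ← key]
  simp only [mul_assoc]

end Simplicity

end LeavittAlgebra

/-! ### Sums over words of fixed length. -/

section WordSum

variable {K : Type*} [Field K] {α : Type*} [Fintype α]

/-- The sum of the values of a function over all words of length `k`. -/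
def wordSum : ℕ → (List α → K) → K
  | 0, f => f []
  | k + 1, f => ∑ i, wordSum k fun w => f (i :: w)

theorem wordSum_congr {k : ℕ} {f g : List α → K} (h : ∀ w, w.length = k → f w = g w) :
    wordSum k f = wordSum k g := by
  induction k generalizing f g with
  | zero => exact h [] rfl
  | succ k ih => exact Finset.sum_congr rfl fun i _ => ih fun w hw => h _ (by simp [hw])

theorem wordSum_add (k : ℕ) (f g : List α → K) :
    wordSum k (fun w => f w + g w) = wordSum k f + wordSum k g := by
  induction k generalizing f g with
  | zero => rfl
  | succ k ih => simp only [wordSum, ih, Finset.sum_add_distrib]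

theorem wordSum_smul (k : ℕ) (c : K) (f : List α → K) :
    wordSum k (fun w => c * f w) = c * wordSum k f := by
  induction k generalizing f with
  | zero => rfl
  | succ k ih => simp only [wordSum, ih, Finset.mul_sum]

theorem wordSum_zero (k : ℕ) : wordSum k (fun _ : List α => (0 : K)) = 0 := by
  simpa using wordSum_smul k (0 : K) (fun _ : List α => (0 : K))

theorem wordSum_one (k : ℕ) : wordSum k (fun _ : List α => (1 : K)) = (Fintype.card α : K) ^ k := by
  induction k with
  | zero => simp [wordSum]
  | succ k ih => simp [wordSum, ih, pow_succ']

end WordSum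

namespace LeavittAlgebra

/-! ### Operators on words and their level traces. -/

section Operators

variable (K : Type*) [Field K] {n : ℕ}

/-- The operator on the space with basis all words that prepends the letter `i`. -/
noncomputable def consOp (i : Fin n) : Module.End K (List (Fin n) →₀ K) :=
  Finsupp.lmapDomain K K (List.cons i)

/-- The operator on the space with basis all words that removes the leading letter `i`, and kills
the words that do not start with `i`. -/
noncomputable def tailOp (i : Fin n) : Module.End K (List (Fin n) →₀ K) :=
  Finsupp.lcomapDomain (List.cons i) (List.cons_injective)

theorem consOp_single (i : Fin n) (w : List (Fin n)) (c : K) :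
    consOp K i (Finsupp.single w c) = Finsupp.single (i :: w) c := by
  simp [consOp]

theorem consOp_apply_cons (i j : Fin n) (f : List (Fin n) →₀ K) (w : List (Fin n)) :
    consOp K i f (j :: w) = if i = j then f w else 0 := by
  split_ifs with h
  · subst h
    exact Finsupp.mapDomain_apply List.cons_injective f w
  · exact Finsupp.mapDomain_of_notMem_range _ _ (by rintro ⟨v, hv⟩; simp at hv; exact h hv.1)

theorem consOp_apply_nil (i : Fin n) (f : List (Fin n) →₀ K) : consOp K i f [] = 0 :=
  Finsupp.mapDomain_of_notMem_range _ _ (by simp)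

theorem tailOp_apply (i : Fin n) (f : List (Fin n) →₀ K) (w : List (Fin n)) :
    tailOp K i f w = f (i :: w) := rfl

theorem tailOp_single_cons (i j : Fin n) (w : List (Fin n)) (c : K) :
    tailOp K i (Finsupp.single (j :: w) c) = if i = j then Finsupp.single w c else 0 := by
  ext v
  rw [tailOp_apply]
  split_ifs with h
  · subst h; simp [Finsupp.single_apply]
  · simp [Ne.symm h]

theorem tailOp_mul_consOp (i j : Fin n) :
    tailOp K i * consOp K j = if i = j then 1 else 0 := by
  ext w : 2
  rw [LinearMap.comp_apply, Finsupp.lsingle_apply, Module.End.mul_apply, consOp_single,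
    tailOp_single_cons]
  split_ifs <;> simp

/-- The trace of an operator on the span of the words of length `k`. -/
noncomputable def levelTrace (k : ℕ) : Module.End K (List (Fin n) →₀ K) →ₗ[K] K where
  toFun f := wordSum k fun w => f (Finsupp.single w 1) w
  map_add' f g := by simpa using wordSum_add k _ _
  map_smul' c f := by simpa using wordSum_smul k c _

theorem levelTrace_apply (k : ℕ) (f : Module.End K (List (Fin n) →₀ K)) :
    levelTrace K k f = wordSum k fun w => f (Finsupp.single w 1) w := rfl

/-- The diagonal coefficient of `consOp K i * f` at `j :: w` vanishes unless `j = i`, and is then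
that of `f * consOp K i` at `w`. -/
theorem levelTrace_consOp_mul (k : ℕ) (i : Fin n) (f : Module.End K (List (Fin n) →₀ K)) :
    levelTrace K (k + 1) (consOp K i * f) = levelTrace K k (f * consOp K i) := by
  rw [levelTrace_apply, levelTrace_apply, wordSum, Finset.sum_eq_single_of_mem i (by simp)]
  · refine wordSum_congr fun w _ => ?_
    simp [consOp_apply_cons, consOp_single]
  · intro j _ hj
    rw [← wordSum_zero (K := K) (α := Fin n) k]
    refine wordSum_congr fun w _ => ?_
    simp [consOp_apply_cons, hj.symm]

theorem levelTrace_mul_tailOp (k : ℕ) (i : Fin n) (f : Module.End K (List (Fin n) →₀ K)) :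
    levelTrace K (k + 1) (f * tailOp K i) = levelTrace K k (tailOp K i * f) := by
  rw [levelTrace_apply, levelTrace_apply, wordSum, Finset.sum_eq_single_of_mem i (by simp)]
  · refine wordSum_congr fun w _ => ?_
    simp [tailOp_apply, tailOp_single_cons]
  · intro j _ hj
    rw [← wordSum_zero (K := K) (α := Fin n) k]
    refine wordSum_congr fun w _ => ?_
    simp [tailOp_single_cons, hj.symm]

theorem levelTrace_one (k : ℕ) :
    levelTrace K k (1 : Module.End K (List (Fin n) →₀ K)) = (n : K) ^ k := by
  rw [levelTrace_apply]
  simpa using wordSum_one (K := K) (α := Fin n) k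

variable (n) in
/-- The ideal of operators of finite rank. -/
def finiteRank : Ideal (Module.End K (List (Fin n) →₀ K)) where
  carrier := {f | (LinearMap.range f).FG}
  zero_mem' := by
    change (LinearMap.range (0 : Module.End K (List (Fin n) →₀ K))).FG
    rw [LinearMap.range_zero]; exact Submodule.fg_bot
  add_mem' {f g} hf hg := by
    change (LinearMap.range (f + g)).FG
    have : (LinearMap.range f ⊔ LinearMap.range g).FG := Submodule.FG.sup hf hg
    have := Submodule.FG.of_le this (LinearMap.range_add_le f g)
    exact this
  smul_mem' g f hf := by
    change (LinearMap.range (g ∘ₗ f)).FG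
    rw [LinearMap.range_comp]
    exact Submodule.FG.map g hf

instance : (finiteRank K n).IsTwoSided where
  mul_mem_of_left {f} g hf := by
    change (LinearMap.range (f ∘ₗ g)).FG
    exact Submodule.FG.of_le hf (LinearMap.range_comp_le_range g f)

/-- The sum fixes nonempty words and kills the empty one. This rank-one defect is the reason for
working modulo finite rank. -/
theorem sum_consOp_mul_tailOp_sub_one_mem :
    ∑ i : Fin n, consOp K i * tailOp K i - 1 ∈ finiteRank K n := by
  have hle : LinearMap.range (∑ i : Fin n, consOp K i * tailOp K i - 1) ≤
      Submodule.span K {Finsupp.single ([] : List (Fin n)) (1 : K)} := by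
    rintro _ ⟨f, rfl⟩
    rw [Submodule.mem_span_singleton]
    refine ⟨-f [], ?_⟩
    ext w
    cases w with
    | nil => simp [consOp_apply_nil]
    | cons i w => simp [consOp_apply_cons, tailOp_apply]
  exact Submodule.FG.of_le (Submodule.fg_span_singleton _) hle

/-- An operator of finite rank has trace zero on the words of any large enough length. -/
theorem eventually_levelTrace_eq_zero {f : Module.End K (List (Fin n) →₀ K)}
    (hf : f ∈ finiteRank K n) : ∀ᶠ k in Filter.atTop, levelTrace K k f = 0 := by
  obtain ⟨s, hs⟩ : (LinearMap.range f).FG := hf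
  -- The bound is the total length of all words supporting the finitely many generators of the
  -- range; a longer word lies in none of the supports.
  have key : ∀ g ∈ LinearMap.range f, ∀ w : List (Fin n),
      (∑ h ∈ s, ∑ v ∈ h.support, v.length) < w.length → g w = 0 := by
    intro g hg w hw
    rw [← hs] at hg
    induction hg using Submodule.span_induction with
    | mem g hg =>
      by_contra hne
      have h1 := Finset.single_le_sum (f := fun h : List (Fin n) →₀ K =>
        ∑ v ∈ h.support, v.length) (by simp) hg
      have h2 := Finset.single_le_sum (f := List.length) (s := g.support) (by simp)
        (Finsupp.mem_support_iff.2 hne)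
      omega
    | zero => rfl
    | add a b _ _ ha hb => simp [ha, hb]
    | smul c a _ ha => simp [ha]
  filter_upwards [Filter.eventually_gt_atTop (∑ h ∈ s, ∑ v ∈ h.support, v.length)] with k hk
  rw [levelTrace_apply, ← wordSum_zero (K := K) (α := Fin n) k]
  exact wordSum_congr fun w hw => key _ ⟨_, rfl⟩ w (by omega)

set_option maxSynthPendingDepth 3 in
variable (n) in
/-- The germ at infinity of the sequence of traces of an operator modulo finite rank. -/
noncomputable def germTrace :
    (Module.End K (List (Fin n) →₀ K) ⧸ finiteRank K n) →+ Filter.Germ Filter.atTop K (α := ℕ) :=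
  QuotientAddGroup.lift _
    { toFun := fun f => ((fun k => levelTrace K k f : ℕ → K) : Filter.Germ Filter.atTop K)
      map_zero' := by simp; rfl
      map_add' := fun f g => by simp; rfl }
    (by
      intro f hf
      exact Filter.Germ.coe_eq.2 (eventually_levelTrace_eq_zero K hf))

set_option maxSynthPendingDepth 3 in
theorem germTrace_mk (f : Module.End K (List (Fin n) →₀ K)) :
    germTrace K n (Ideal.Quotient.mk _ f) =
      ((fun k => levelTrace K k f : ℕ → K) : Filter.Germ Filter.atTop K) := rfl

end Operators
end LeavittAlgebra

namespace LeavittAlgebra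

/-! ### The trace on the Leavitt algebra when `n = 1` in `K`. -/

section Trace

variable (K : Type*) [Field K] {n : ℕ}

set_option maxSynthPendingDepth 3

theorem germTrace_smul (c : K) (q : Module.End K (List (Fin n) →₀ K) ⧸ finiteRank K n) :
    germTrace K n (c • q) = c • germTrace K n q := by
  obtain ⟨f, rfl⟩ := Ideal.Quotient.mk_surjective q
  have : c • Ideal.Quotient.mk (finiteRank K n) f = Ideal.Quotient.mk _ (c • f) := rfl
  rw [this, germTrace_mk, germTrace_mk]
  simp only [map_smul]
  rfl

variable (n) in
/-- The representation of the Leavitt algebra on words, modulo operators of finite rank. -/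
noncomputable def wordRep :
    LeavittAlgebra K n →ₐ[K] Module.End K (List (Fin n) →₀ K) ⧸ finiteRank K n :=
  lift K (a := fun i => Ideal.Quotient.mk _ (consOp K i))
    (b := fun i => Ideal.Quotient.mk _ (tailOp K i))
    (by
      intro i j
      rw [← map_mul, tailOp_mul_consOp, apply_ite (Ideal.Quotient.mk _), map_one, map_zero])
    (by
      simp only [← map_mul, ← map_sum]
      rw [← map_one (Ideal.Quotient.mk _)]
      exact Ideal.Quotient.eq.2 (sum_consOp_mul_tailOp_sub_one_mem K))

theorem wordRep_x (i : Fin n) : wordRep K n (x K i) = Ideal.Quotient.mk _ (consOp K i) :=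
  lift_x ..

theorem wordRep_y (i : Fin n) : wordRep K n (y K i) = Ideal.Quotient.mk _ (tailOp K i) :=
  lift_y ..

/-- The operator that prepends the word `w`. -/
noncomputable def appendOp (w : List (Fin n)) : Module.End K (List (Fin n) →₀ K) :=
  (w.map (consOp K)).prod

/-- The operator that removes the prefix `w`. -/
noncomputable def dropOp (w : List (Fin n)) : Module.End K (List (Fin n) →₀ K) :=
  (w.reverse.map (tailOp K)).prod

theorem wordRep_xWord (w : List (Fin n)) :
    wordRep K n (xWord K w) = Ideal.Quotient.mk _ (appendOp K w) := by
  rw [xWord, appendOp, map_list_prod, map_list_prod, List.map_map, List.map_map]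
  congr 2
  funext i
  exact wordRep_x K i

theorem wordRep_yWord (w : List (Fin n)) :
    wordRep K n (yWord K w) = Ideal.Quotient.mk _ (dropOp K w) := by
  rw [yWord, dropOp, map_list_prod, map_list_prod, List.map_map, List.map_map]
  congr 2
  funext i
  exact wordRep_y K i

theorem levelTrace_appendOp_mul (k : ℕ) (w : List (Fin n))
    (f : Module.End K (List (Fin n) →₀ K)) :
    levelTrace K (k + w.length) (appendOp K w * f) = levelTrace K k (f * appendOp K w) := by
  induction w generalizing f with
  | nil => simp [appendOp]
  | cons i w ih =>
    have : appendOp K (i :: w) = consOp K i * appendOp K w := by simp [appendOp]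
    rw [this, List.length_cons, ← add_assoc, mul_assoc, levelTrace_consOp_mul, mul_assoc, ih,
      mul_assoc]

theorem levelTrace_appendOp (k : ℕ) {w : List (Fin n)} (hw : w ≠ []) :
    levelTrace K k (appendOp K w) = 0 := by
  have h : ∀ v, appendOp K w (Finsupp.single v 1) = Finsupp.single (w ++ v) 1 := by
    intro v
    clear hw
    induction w with
    | nil => simp [appendOp]
    | cons i w ih =>
      have : appendOp K (i :: w) = consOp K i * appendOp K w := by simp [appendOp]
      rw [this, Module.End.mul_apply, ih, consOp_single, List.cons_append]
  rw [levelTrace_apply, ← wordSum_zero (K := K) (α := Fin n) k]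
  refine wordSum_congr fun v _ => ?_
  rw [h, Finsupp.single_apply, if_neg (by simpa using hw)]

theorem levelTrace_dropOp (k : ℕ) {w : List (Fin n)} (hw : w ≠ []) :
    levelTrace K k (dropOp K w) = 0 := by
  have h : ∀ f v, dropOp K w f v = f (w ++ v) := by
    intro f v
    clear hw
    induction w generalizing f with
    | nil => simp [dropOp]
    | cons i w ih =>
      have : dropOp K (i :: w) = dropOp K w * tailOp K i := by simp [dropOp]
      rw [this, Module.End.mul_apply, ih, tailOp_apply, List.cons_append]
  rw [levelTrace_apply, ← wordSum_zero (K := K) (α := Fin n) k]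
  refine wordSum_congr fun v _ => ?_
  rw [h, Finsupp.single_apply, if_neg (by simpa using hw)]

variable (n) in
/-- The sequence of traces of an element of the Leavitt algebra, as a germ at infinity. -/
noncomputable def trace : LeavittAlgebra K n →ₗ[K] Filter.Germ (Filter.atTop : Filter ℕ) K where
  toFun a := germTrace K n (wordRep K n a)
  map_add' a b := by rw [map_add, map_add]
  map_smul' c a := by rw [map_smul, germTrace_smul, RingHom.id_apply]

theorem trace_eq_of_wordRep_eq {a : LeavittAlgebra K n} {f : Module.End K (List (Fin n) →₀ K)}
    (h : wordRep K n a = Ideal.Quotient.mk _ f) :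
    trace K n a = ((fun k => levelTrace K k f : ℕ → K) : Filter.Germ Filter.atTop K) := by
  rw [← germTrace_mk, ← h]; rfl

theorem trace_one (hn : (n : K) = 1) : trace K n 1 = ((1 : K) : Filter.Germ _ K) := by
  rw [trace_eq_of_wordRep_eq K (f := 1) (by rw [map_one, map_one])]
  simp only [levelTrace_one, hn, one_pow]
  rfl

/-- The product reduces to zero or a single word. Nonempty words have no diagonal coefficients, and
the empty one has level traces `n ^ k = 1`. -/
theorem trace_yWord_mul_xWord (hn : (n : K) = 1) (u v : List (Fin n)) :
    ∃ c : K, trace K n (yWord K v * xWord K u) = (c : Filter.Germ _ K) := by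
  rcases yWord_mul_xWord_eq_or K v u with h | ⟨w, h, -⟩ | ⟨w, h, -⟩
  · exact ⟨0, by rw [h, map_zero]; rfl⟩
  · rw [h]
    by_cases hw : w = []
    · exact ⟨1, by rw [hw, xWord_nil, trace_one K hn]⟩
    · refine ⟨0, ?_⟩
      rw [trace_eq_of_wordRep_eq K (wordRep_xWord K w)]
      simp only [levelTrace_appendOp K _ hw]
      rfl
  · rw [h]
    by_cases hw : w = []
    · exact ⟨1, by rw [hw, yWord_nil, trace_one K hn]⟩
    · refine ⟨0, ?_⟩
      rw [trace_eq_of_wordRep_eq K (wordRep_yWord K w)]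
      simp only [levelTrace_dropOp K _ hw]
      rfl

/-- If `n = 1` in `K`, then the sequence of traces is eventually constant. -/
theorem exists_trace_eq_const (hn : (n : K) = 1) (a : LeavittAlgebra K n) :
    ∃ c : K, trace K n a = (c : Filter.Germ _ K) := by
  have ha : a ∈ Submodule.span K (Set.range fun p : List (Fin n) × List (Fin n) =>
      xWord K p.1 * yWord K p.2) := by rw [span_monomials_eq_top]; trivial
  induction ha using Submodule.span_induction with
  | mem a ha =>
    obtain ⟨⟨u, v⟩, rfl⟩ := ha
    -- Moving `xWord K u` to the right shifts the level by `u.length`, which does not affect being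
    -- eventually constant.
    obtain ⟨c, hc⟩ := trace_yWord_mul_xWord K hn u v
    refine ⟨c, ?_⟩
    dsimp only
    rw [trace_eq_of_wordRep_eq K (f := dropOp K v * appendOp K u)
      (by rw [map_mul, map_mul, wordRep_yWord, wordRep_xWord])] at hc
    rw [trace_eq_of_wordRep_eq K (f := appendOp K u * dropOp K v)
      (by rw [map_mul, map_mul, wordRep_yWord, wordRep_xWord])]
    have h1 := Filter.eventually_atTop.1 (Filter.Germ.coe_eq.1 hc)
    obtain ⟨N, hN⟩ := h1
    refine Filter.Germ.coe_eq.2 (Filter.eventually_atTop.2 ⟨N + u.length, fun k hk => ?_⟩)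
    obtain ⟨k, rfl⟩ : ∃ k', k = k' + u.length := ⟨k - u.length, by omega⟩
    exact (levelTrace_appendOp_mul K k u _).trans <| hN k (by omega)
  | zero => exact ⟨0, by rw [map_zero]; rfl⟩
  | add a b _ _ ha hb =>
    obtain ⟨c, hc⟩ := ha
    obtain ⟨c', hc'⟩ := hb
    exact ⟨c + c', by rw [map_add, hc, hc']; rfl⟩
  | smul c a _ ha =>
    obtain ⟨c', hc'⟩ := ha
    exact ⟨c * c', by rw [map_smul, hc']; rfl⟩

/-- Both sequences are eventually constant, so a shift of the index cannot separate their limiting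
values. -/
theorem trace_eq_of_levelTrace_succ (hn : (n : K) = 1) {a b : LeavittAlgebra K n}
    {f g : Module.End K (List (Fin n) →₀ K)} (hf : wordRep K n a = Ideal.Quotient.mk _ f)
    (hg : wordRep K n b = Ideal.Quotient.mk _ g)
    (h : ∀ k, levelTrace K (k + 1) f = levelTrace K k g) : trace K n a = trace K n b := by
  obtain ⟨c, hc⟩ := exists_trace_eq_const K hn a
  obtain ⟨c', hc'⟩ := exists_trace_eq_const K hn b
  rw [hc, hc']
  rw [trace_eq_of_wordRep_eq K hf] at hc
  rw [trace_eq_of_wordRep_eq K hg] at hc'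
  obtain ⟨N, hN⟩ := Filter.eventually_atTop.1 (Filter.Germ.coe_eq.1 hc)
  obtain ⟨M, hM⟩ := Filter.eventually_atTop.1 (Filter.Germ.coe_eq.1 hc')
  have h1 : levelTrace K (N + M + 1) f = c := hN _ (by omega)
  have h2 : levelTrace K (N + M) g = c' := hM _ (by omega)
  rw [← h1, ← h2, h]

/-- Letting `b` vary in the induction reduces cyclicity to generators, where it holds up to a shift
of level. -/
theorem trace_mul_comm (hn : (n : K) = 1) (a b : LeavittAlgebra K n) :
    trace K n (a * b) = trace K n (b * a) := by
  induction a using induction_on generalizing b with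
  | algebraMap c => rw [Algebra.commutes]
  | x i =>
    obtain ⟨f, hf⟩ := Ideal.Quotient.mk_surjective (wordRep K n b)
    exact trace_eq_of_levelTrace_succ K hn (f := consOp K i * f) (g := f * consOp K i)
      (by rw [map_mul, map_mul, hf, wordRep_x]) (by rw [map_mul, map_mul, hf, wordRep_x])
      fun k => levelTrace_consOp_mul K k i f
  | y i =>
    obtain ⟨f, hf⟩ := Ideal.Quotient.mk_surjective (wordRep K n b)
    exact (trace_eq_of_levelTrace_succ K hn (f := f * tailOp K i) (g := tailOp K i * f)
      (by rw [map_mul, map_mul, hf, wordRep_y]) (by rw [map_mul, map_mul, hf, wordRep_y])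
      fun k => levelTrace_mul_tailOp K k i f).symm
  | mul a a' ha ha' => rw [mul_assoc, ha, mul_assoc, ha', mul_assoc]
  | add a a' ha ha' => rw [add_mul, mul_add, map_add, map_add, ha, ha']

variable {ι : Type*} [Fintype ι] [DecidableEq ι]

theorem trace_trace_eq_zero_of_mem_commutator (hn : (n : K) = 1)
    {A : Matrix ι ι (LeavittAlgebra K n)} (hA : A ∈ commutatorLieAlgebra K _) :
    trace K n A.trace = 0 := by
  change A ∈ Submodule.span K {c : Matrix ι ι (LeavittAlgebra K n) |
    ∃ a b, c = a * b - b * a} at hA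
  induction hA using Submodule.span_induction with
  | mem A hA =>
    obtain ⟨B, C, rfl⟩ := hA
    rw [Matrix.trace_sub, map_sub, sub_eq_zero]
    simp only [Matrix.trace, Matrix.diag_apply, Matrix.mul_apply, map_sum]
    rw [Finset.sum_comm]
    exact Finset.sum_congr rfl fun i _ => Finset.sum_congr rfl fun j _ => trace_mul_comm K hn _ _
  | zero => simp
  | add A B _ _ hA hB => rw [Matrix.trace_add, map_add, hA, hB, add_zero]
  | smul c A _ hA => rw [Matrix.trace_smul, map_smul, hA, smul_zero]

/-- If `n = 1` in `K` and the size of the matrices is nonzero in `K`, then the only scalar matrix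
in the commutator Lie algebra is zero. -/
theorem eq_zero_of_algebraMap_mem_commutator (hn : (n : K) = 1)
    (hι : (Fintype.card ι : K) ≠ 0) {c : K}
    (hc : algebraMap K (Matrix ι ι (LeavittAlgebra K n)) c ∈ commutatorLieAlgebra K _) :
    c = 0 := by
  have h := trace_trace_eq_zero_of_mem_commutator K hn hc
  rw [Algebra.algebraMap_eq_smul_one, Matrix.trace_smul, Matrix.trace_one, map_smul,
    ← nsmul_one, map_nsmul, trace_one K hn] at h
  have h2 : ((c * (Fintype.card ι * 1) : K) : Filter.Germ (Filter.atTop : Filter ℕ) K) =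
      ((0 : K) : Filter.Germ _ K) := by
    rw [← nsmul_eq_mul]
    exact h
  have h3 := Filter.Germ.const_inj.1 h2
  simpa [hι] using h3

end Trace

end LeavittAlgebra

/-! ### Transport along isomorphisms, and the obstruction from `1 ∈ [A, A]`. -/

section CommutatorLieAlgebra

variable {K : Type*} [Field K]

theorem commutator_mem_commutatorLieAlgebra {A : Type*} [Ring A] [Algebra K A] (a b : A) :
    a * b - b * a ∈ commutatorLieAlgebra K A :=
  Submodule.subset_span ⟨a, b, rfl⟩

theorem commutatorLieAlgebra_le {A : Type*} [Ring A] [Algebra K A] {U : Submodule K A}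
    (h : ∀ a b : A, a * b - b * a ∈ U) : (commutatorLieAlgebra K A).toSubmodule ≤ U :=
  Submodule.span_le.2 (by rintro _ ⟨a, b, rfl⟩; exact h a b)

theorem commutatorLieAlgebra_map_algEquiv {A B : Type*} [Ring A] [Algebra K A] [Ring B]
    [Algebra K B] (e : A ≃ₐ[K] B) :
    (commutatorLieAlgebra K A).map (e.toLieEquiv : A →ₗ⁅K⁆ B) = commutatorLieAlgebra K B := by
  ext b
  constructor
  · rintro ⟨a, ha, rfl⟩
    have h : (commutatorLieAlgebra K A).toSubmodule ≤
        (commutatorLieAlgebra K B).toSubmodule.comap e.toLinearMap := by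
      refine commutatorLieAlgebra_le fun a b => ?_
      change e (a * b - b * a) ∈ commutatorLieAlgebra K B
      rw [map_sub, map_mul, map_mul]
      exact commutator_mem_commutatorLieAlgebra _ _
    exact h ha
  · intro hb
    have h : (commutatorLieAlgebra K B).toSubmodule ≤
        (commutatorLieAlgebra K A).toSubmodule.comap e.symm.toLinearMap := by
      refine commutatorLieAlgebra_le fun a b => ?_
      change e.symm (a * b - b * a) ∈ commutatorLieAlgebra K A
      rw [map_sub, map_mul, map_mul]
      exact commutator_mem_commutatorLieAlgebra _ _
    exact ⟨e.symm b, h hb, e.apply_symm_apply b⟩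

theorem isSimple_of_lieEquiv {L M : Type*} [LieRing L] [LieAlgebra K L] [LieRing M]
    [LieAlgebra K M] (e : L ≃ₗ⁅K⁆ M) (h : LieAlgebra.IsSimple K M) :
    LieAlgebra.IsSimple K L where
  non_abelian hL := h.non_abelian ((lie_abelian_iff_equiv_lie_abelian e).1 hL)
  eq_bot_or_eq_top I := by
    have hmem : ∀ x : L, x ∈ I ↔ e x ∈ LieIdeal.comap (e.symm : M →ₗ⁅K⁆ L) I := by
      intro x
      rw [LieIdeal.mem_comap]
      simp
    rcases h.eq_bot_or_eq_top (LieIdeal.comap (e.symm : M →ₗ⁅K⁆ L) I) with h | h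
    · left
      rw [LieSubmodule.eq_bot_iff]
      intro x hx
      rw [hmem, h, LieSubmodule.mem_bot] at hx
      exact e.injective (hx.trans (map_zero e).symm)
    · right
      rw [eq_top_iff]
      intro x _
      rw [hmem, h]
      trivial

/-- The commutator Lie algebra is simple for one of two isomorphic algebras if it is simple for
the other. -/
theorem commutatorLieAlgebra_isSimple_of_algEquiv {A B : Type*} [Ring A] [Algebra K A] [Ring B]
    [Algebra K B] (e : A ≃ₐ[K] B) (h : LieAlgebra.IsSimple K (commutatorLieAlgebra K B)) :
    LieAlgebra.IsSimple K (commutatorLieAlgebra K A) :=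
  isSimple_of_lieEquiv
    (e.toLieEquiv.ofSubalgebras _ _ (commutatorLieAlgebra_map_algEquiv e)) h

/-- If `1` is a sum of commutators, then the scalars form a Lie ideal of `[A, A]`. -/
theorem not_isSimple_of_one_mem {A : Type*} [Ring A] [Algebra K A]
    (h1 : (1 : A) ∈ commutatorLieAlgebra K A) :
    ¬ LieAlgebra.IsSimple K (commutatorLieAlgebra K A) := by
  intro h
  let u : commutatorLieAlgebra K A := ⟨1, h1⟩
  have hu : ∀ v : commutatorLieAlgebra K A, ⁅v, u⁆ = 0 := by
    intro v
    ext
    rw [LieSubalgebra.coe_bracket, LieRing.of_associative_ring_bracket]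
    simp [u]
  let I : LieIdeal K (commutatorLieAlgebra K A) :=
    { Submodule.span K {u} with
      lie_mem := by
        intro v m hm
        obtain ⟨c, rfl⟩ := Submodule.mem_span_singleton.1 hm
        rw [lie_smul, hu, smul_zero]
        exact Submodule.zero_mem _ }
  have hI : ∀ v, v ∈ I → ∃ c : K, c • u = v := fun v hv => Submodule.mem_span_singleton.1 hv
  have huI : u ∈ I := Submodule.mem_span_singleton_self u
  apply h.non_abelian
  refine ⟨fun v w => ?_⟩
  -- Either `1 = 0` in `A`, or every element is a multiple of the central `u`; the bracket vanishes
  -- in both cases.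
  rcases h.eq_bot_or_eq_top I with h | h
  · rw [h, LieSubmodule.mem_bot] at huI
    have h10 : (1 : A) = 0 := congrArg Subtype.val huI
    ext
    exact eq_zero_of_zero_eq_one h10.symm _
  · obtain ⟨c, rfl⟩ := hI w (by rw [h]; trivial)
    rw [lie_smul, hu, smul_zero]

end CommutatorLieAlgebra

theorem Fintype.exists_ne_and_ne {ι : Type*} [Fintype ι] (hι : 3 ≤ Fintype.card ι) (p q : ι) :
    ∃ i, i ≠ p ∧ i ≠ q := by
  classical
  by_contra! hcon
  have : (Finset.univ : Finset ι) ⊆ {p, q} := fun i _ => by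
    by_cases hi : i = p
    · simp [hi]
    · simp [hcon i hi]
  have := (Finset.card_le_card this).trans Finset.card_le_two
  rw [Finset.card_univ] at this
  omega

namespace Matrix

/-! ### Lie ideals in matrices of size at least three. -/

section LieIdeal

variable {K S ι : Type*} [Field K] [Ring S] [Algebra K S] [Fintype ι] [DecidableEq ι]

theorem single_mem_commutatorLieAlgebra {i j : ι} (hij : i ≠ j) (a : S) :
    single i j a ∈ commutatorLieAlgebra K (Matrix ι ι S) := by
  have h := commutator_mem_commutatorLieAlgebra (K := K) (single i i (1 : S)) (single i j a)
  rwa [single_mul_single_same, single_mul_single_of_ne _ _ _ _ hij.symm, sub_zero, one_mul] at h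

variable {U : Submodule K (Matrix ι ι S)}

/-- Bracket `u` successively with `X = b e_qi`, `Y = s a e_qp` and `Z = e_ip`, where `a * u p q * b
= 1`. With `i` distinct from `p` and `q`, the products `XY`, `YX`, `YZ`, `ZY`, `ZX` vanish, and only
`-Y u X Z = -s e_qp` survives. -/
theorem single_mem_of_apply_ne_zero
    (hU : ∀ u ∈ U, ∀ i j, i ≠ j → ∀ a : S, u * single i j a - single i j a * u ∈ U)
    (hι : 3 ≤ Fintype.card ι)
    (hS : ∀ s : S, s ≠ 0 → ∃ a b, a * s * b = 1)
    {u : Matrix ι ι S} (hu : u ∈ U) {p q : ι} (hpq : p ≠ q) (h : u p q ≠ 0) (s : S) :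
    single q p s ∈ U := by
  obtain ⟨i, hip, hiq⟩ : ∃ i, i ≠ p ∧ i ≠ q := Fintype.exists_ne_and_ne hι p q
  obtain ⟨a, b, hab⟩ := hS _ h
  have h1 := hU _ (hU _ (hU _ hu q i hiq.symm b) q p hpq.symm (s * a)) i p hip 1
  have hXY : single q i b * single q p (s * a) = 0 := single_mul_single_of_ne _ _ _ _ hiq _
  have hYX : single q p (s * a) * single q i b = 0 := single_mul_single_of_ne _ _ _ _ hpq _
  have hYZ : single q p (s * a) * single i p (1 : S) = 0 :=
    single_mul_single_of_ne _ _ _ _ hip.symm _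
  have hZY : single i p (1 : S) * single q p (s * a) = 0 := single_mul_single_of_ne _ _ _ _ hpq _
  have hZX : single i p (1 : S) * single q i b = 0 := single_mul_single_of_ne _ _ _ _ hpq _
  have hYuXZ : single q p (s * a) * u * (single q i b * single i p (1 : S)) = single q p s := by
    rw [single_mul_single_same, single_mul_mul_single, mul_one, mul_assoc s, mul_assoc s, hab,
      mul_one]
  generalize single q i b = X at *
  generalize single q p (s * a) = Y at *
  generalize single i p (1 : S) = Z at *
  have : ((u * X - X * u) * Y - Y * (u * X - X * u)) * Z -
      Z * ((u * X - X * u) * Y - Y * (u * X - X * u)) = -(Y * u * (X * Z)) := by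
    calc _ = u * (X * Y) * Z - X * u * (Y * Z) - Y * u * (X * Z) + (Y * X) * u * Z
          - Z * u * (X * Y) + (Z * X) * u * Y + (Z * Y) * u * X - (Z * Y) * X * u := by
            noncomm_ring
      _ = _ := by rw [hXY, hYX, hYZ, hZY, hZX]; simp
  rw [this, hYuXZ] at h1
  simpa using U.neg_mem h1

theorem single_row_mem
    (hU : ∀ u ∈ U, ∀ i j, i ≠ j → ∀ a : S, u * single i j a - single i j a * u ∈ U)
    {p q j : ι} (hqj : q ≠ j)
    (h : ∀ s : S, single q p s ∈ U) (s : S) : single q j s ∈ U := by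
  by_cases hj : p = j
  · subst hj; exact h s
  have h1 := hU _ (h s) p j hj 1
  rwa [single_mul_single_same, single_mul_single_of_ne _ _ _ _ hqj.symm, sub_zero, mul_one] at h1

theorem single_col_mem
    (hU : ∀ u ∈ U, ∀ i j, i ≠ j → ∀ a : S, u * single i j a - single i j a * u ∈ U)
    {p q i : ι} (hip : i ≠ p)
    (h : ∀ s : S, single q p s ∈ U) (s : S) : single i p s ∈ U := by
  by_cases hi : i = q
  · subst hi; exact h s
  have h1 := hU _ (h s) i q hi 1
  rw [single_mul_single_same, single_mul_single_of_ne _ _ _ _ hip.symm, zero_sub, one_mul] at h1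
  simpa using U.neg_mem h1

/-- The position moves along `(q, p)`, `(q, r)`, `(i, r)`, `(i, j)`; choosing `r` different from `q`
and `i` keeps it off the diagonal. -/
theorem forall_single_mem
    (hU : ∀ u ∈ U, ∀ i j, i ≠ j → ∀ a : S, u * single i j a - single i j a * u ∈ U)
    (hι : 3 ≤ Fintype.card ι) {p q : ι}
    (h : ∀ s : S, single q p s ∈ U) {i j : ι} (hij : i ≠ j) (s : S) : single i j s ∈ U := by
  obtain ⟨r, hrq, hri⟩ : ∃ r, r ≠ q ∧ r ≠ i := Fintype.exists_ne_and_ne hι q i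
  exact single_row_mem hU hij
    (single_col_mem hU hri.symm (single_row_mem hU hrq.symm h)) s

theorem commutatorLieAlgebra_le_of_forall_single_mem
    (hU : ∀ u ∈ U, ∀ i j, i ≠ j → ∀ a : S, u * single i j a - single i j a * u ∈ U)
    (hι : 3 ≤ Fintype.card ι)
    (h : ∀ i j, i ≠ j → ∀ s : S, single i j s ∈ U) :
    (commutatorLieAlgebra K (Matrix ι ι S)).toSubmodule ≤ U := by
  have hne : ∀ i j : ι, i ≠ j → ∀ a b : S, single i i (a * b) - single j j (b * a) ∈ U := by
    intro i j hij a b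
    have := hU _ (h i j hij a) j i hij.symm b
    rwa [single_mul_single_same, single_mul_single_same] at this
  have hdiag : ∀ (i j : ι) (a b : S), single i i (a * b) - single j j (b * a) ∈ U := by
    intro i j a b
    by_cases hij : i = j
    · subst hij
      have : Nontrivial ι := Fintype.one_lt_card_iff_nontrivial.1 (by omega)
      obtain ⟨r, hr⟩ := exists_ne i
      -- A detour through a second index `r`: the two terms `b * a` at `(r, r)` cancel.
      have := U.add_mem (hne i r hr.symm a b) (hne r i hr (b * a) 1)
      rwa [mul_one, one_mul, sub_add_sub_cancel] at this
    · exact hne i j hij a b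
  refine commutatorLieAlgebra_le fun A B => ?_
  induction A using Matrix.induction_on' with
  | h_zero => simp
  | h_add A A' hA hA' =>
    rw [add_mul, mul_add, add_sub_add_comm]
    exact U.add_mem hA hA'
  | h_std_basis i j a =>
    induction B using Matrix.induction_on' with
    | h_zero => simp
    | h_add B B' hB hB' =>
      rw [add_mul, mul_add, add_sub_add_comm]
      exact U.add_mem hB hB'
    | h_std_basis k l b =>
      by_cases hjk : j = k <;> by_cases hli : l = i
      · subst hjk hli
        rw [single_mul_single_same, single_mul_single_same]
        exact hdiag _ _ _ _
      · subst hjk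
        rw [single_mul_single_same, single_mul_single_of_ne _ _ _ _ hli, sub_zero]
        exact h _ _ (Ne.symm hli) _
      · subst hli
        rw [single_mul_single_same, single_mul_single_of_ne _ _ _ _ hjk, zero_sub]
        exact U.neg_mem (h _ _ (Ne.symm hjk) _)
      · rw [single_mul_single_of_ne _ _ _ _ hli, single_mul_single_of_ne _ _ _ _ hjk, sub_zero]
        exact U.zero_mem

/-- A matrix that commutes with all matrices supported on a single off-diagonal entry, and that
is diagonal, is scalar. -/
theorem exists_algebraMap_eq_of_commute_single [Nontrivial ι]
    (hc : ∀ c : S, (∀ a, c * a = a * c) → ∃ k : K, algebraMap K S k = c)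
    {u : Matrix ι ι S} (hdiag : ∀ p q, p ≠ q → u p q = 0)
    (hcomm : ∀ i j, i ≠ j → ∀ a, u i i * a = a * u j j) :
    ∃ k : K, algebraMap K (Matrix ι ι S) k = u := by
  have heq : ∀ i j, u i i = u j j := by
    intro i j
    by_cases hij : i = j
    · rw [hij]
    · simpa using hcomm i j hij 1
  obtain ⟨i, j, hij⟩ := exists_pair_ne ι
  obtain ⟨k, hk⟩ := hc (u i i) fun a => by rw [hcomm i j hij, heq i j]
  refine ⟨k, ?_⟩
  ext p q
  rw [algebraMap_matrix_apply]
  split_ifs with hpq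
  · subst hpq; rw [hk, heq]
  · rw [hdiag p q hpq]

theorem eq_bot_or_commutatorLieAlgebra_le
    (hU : ∀ u ∈ U, ∀ i j, i ≠ j → ∀ a : S, u * single i j a - single i j a * u ∈ U)
    (hι : 3 ≤ Fintype.card ι)
    (hS : ∀ s : S, s ≠ 0 → ∃ a b, a * s * b = 1)
    (hc : ∀ c : S, (∀ a, c * a = a * c) → ∃ k : K, algebraMap K S k = c)
    (hscalar : ∀ k : K, algebraMap K (Matrix ι ι S) k ∈ U → k = 0) :
    U = ⊥ ∨ (commutatorLieAlgebra K (Matrix ι ι S)).toSubmodule ≤ U := by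
  have : Nontrivial ι := Fintype.one_lt_card_iff_nontrivial.1 (by omega)
  by_cases hoff : ∃ u ∈ U, ∃ p q, p ≠ q ∧ u p q ≠ 0
  · right
    obtain ⟨u, hu, p, q, hpq, h⟩ := hoff
    exact commutatorLieAlgebra_le_of_forall_single_mem hU hι fun i j hij s =>
      forall_single_mem hU hι (single_mem_of_apply_ne_zero hU hι hS hu hpq h) hij s
  · left
    push Not at hoff
    rw [Submodule.eq_bot_iff]
    intro u hu
    -- The bracket of `u` with `single i j a` is again in `U`, hence diagonal, and its `(i, j)`
    -- entry is `u i i * a - a * u j j`.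
    obtain ⟨k, rfl⟩ := exists_algebraMap_eq_of_commute_single hc (hoff u hu) fun i j hij a => by
      have h := hoff _ (hU u hu i j hij a) i j hij
      rwa [sub_apply, mul_single_apply_same, single_mul_apply_same, sub_eq_zero] at h
    rw [hscalar k hu, map_zero]

end LieIdeal

/-- Let `S` be a `K`-algebra with scalar centre in which every nonzero element can be carried to
`1` by two-sided multiplication. Then `[M_ι(S), M_ι(S)]` is simple if `ι` has at least three
elements and no nonzero scalar matrix is a sum of commutators. -/
theorem commutatorLieAlgebra_isSimple {K S ι : Type*} [Field K] [Ring S] [Nontrivial S]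
    [Algebra K S] [Fintype ι] [DecidableEq ι] (hι : 3 ≤ Fintype.card ι)
    (hS : ∀ s : S, s ≠ 0 → ∃ a b, a * s * b = 1)
    (hc : ∀ c : S, (∀ a, c * a = a * c) → ∃ k : K, algebraMap K S k = c)
    (hscalar : ∀ k : K,
      algebraMap K (Matrix ι ι S) k ∈ commutatorLieAlgebra K (Matrix ι ι S) → k = 0) :
    LieAlgebra.IsSimple K (commutatorLieAlgebra K (Matrix ι ι S)) where
  eq_bot_or_eq_top I := by
    let U : Submodule K (Matrix ι ι S) :=
      I.toSubmodule.map (commutatorLieAlgebra K (Matrix ι ι S)).toSubmodule.subtype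
    have hmem : ∀ v : commutatorLieAlgebra K (Matrix ι ι S), (v : Matrix ι ι S) ∈ U ↔ v ∈ I := by
      intro v
      constructor
      · rintro ⟨w, hw, hwv⟩
        rwa [← show w = v from Subtype.ext hwv]
      · exact fun hv => ⟨v, hv, rfl⟩
    have hUle : ∀ u ∈ U, u ∈ commutatorLieAlgebra K (Matrix ι ι S) := by
      rintro _ ⟨w, -, rfl⟩
      exact w.2
    have hU : ∀ u ∈ U, ∀ i j, i ≠ j → ∀ a : S, u * single i j a - single i j a * u ∈ U := by
      rintro _ ⟨w, hw, rfl⟩ i j hij a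
      exact ⟨_, lie_mem_left K _ I w ⟨_, single_mem_commutatorLieAlgebra hij a⟩ hw, rfl⟩
    rcases eq_bot_or_commutatorLieAlgebra_le hU hι hS hc
      (fun k hk => hscalar k (hUle _ hk)) with h | h
    · left
      rw [LieSubmodule.eq_bot_iff]
      intro v hv
      have := (hmem v).2 hv
      rw [h, Submodule.mem_bot] at this
      exact Subtype.ext this
    · right
      rw [eq_top_iff]
      intro v _
      exact (hmem v).1 (h v.2)
  non_abelian := by
    intro hab
    obtain ⟨i, j, k, hij, hik, hjk⟩ := Fintype.two_lt_card_iff.1 (show 2 < Fintype.card ι by omega)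
    have h := hab.trivial ⟨_, single_mem_commutatorLieAlgebra (K := K) hij (1 : S)⟩
      ⟨_, single_mem_commutatorLieAlgebra hjk 1⟩
    have h' : single i j (1 : S) * single j k 1 - single j k 1 * single i j 1 = 0 :=
      congrArg Subtype.val h
    rw [single_mul_single_same, single_mul_single_of_ne _ _ _ _ hik.symm, sub_zero, mul_one] at h'
    have := congrFun (congrFun h' i) k
    simp at this

end Matrix

/-! ### Enlarging the matrices, and the two directions of the theorem. -/

namespace LeavittAlgebra

variable (K : Type*) [Field K] (n : ℕ)

/-- The isomorphism `L_K(n) ≃ M_n(L_K(n))` that sends `a` to the matrix `(y i * a * x j)`. -/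
noncomputable def algEquivMatrix :
    LeavittAlgebra K n ≃ₐ[K] Matrix (Fin n) (Fin n) (LeavittAlgebra K n) :=
  AlgEquiv.ofLinearEquiv
    { toFun := fun a => Matrix.of fun i j => y K i * a * x K j
      map_add' := fun a b => by ext i j; simp [mul_add, add_mul]
      map_smul' := fun c a => by ext i j; simp
      invFun := fun A => ∑ i, ∑ j, x K i * A i j * y K j
      left_inv := fun a => by
        have h : ∀ i j : Fin n, x K i * (y K i * a * x K j) * y K j =
            x K i * y K i * a * (x K j * y K j) := fun i j => by simp only [mul_assoc]
        simp only [Matrix.of_apply, h, ← Finset.mul_sum, sum_x_mul_y, mul_one]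
        rw [← Finset.sum_mul, sum_x_mul_y, one_mul]
      right_inv := fun A => by
        ext i j
        simp only [Matrix.of_apply, Finset.mul_sum, Finset.sum_mul]
        have h : ∀ k l : Fin n, y K i * (x K k * A k l * y K l) * x K j =
            (y K i * x K k) * A k l * (y K l * x K j) := fun k l => by simp only [mul_assoc]
        simp only [h, y_mul_x]
        simp }
    (by
      ext i j
      simp [y_mul_x, Matrix.one_apply])
    (fun a b => by
      ext i j
      have h : ∀ k : Fin n, y K i * a * x K k * (y K k * b * x K j) =
          y K i * a * (x K k * y K k) * (b * x K j) := fun k => by simp only [mul_assoc]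
      simp only [LinearEquiv.coe_mk, LinearMap.coe_mk, AddHom.coe_mk, Matrix.of_apply,
        Matrix.mul_apply, h]
      rw [← Finset.sum_mul, ← Finset.mul_sum, sum_x_mul_y]
      simp only [mul_assoc, one_mul])

/-- Matrices over the Leavitt algebra may be enlarged by a factor `n * n`. -/
noncomputable def matrixAlgEquiv (ι : Type*) [Fintype ι] [DecidableEq ι] :
    Matrix ι ι (LeavittAlgebra K n) ≃ₐ[K]
      Matrix ((ι × Fin n) × Fin n) ((ι × Fin n) × Fin n) (LeavittAlgebra K n) :=
  ((algEquivMatrix K n).mapMatrix.trans (Matrix.compAlgEquiv ι (Fin n) _ K)).trans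
    ((algEquivMatrix K n).mapMatrix.trans (Matrix.compAlgEquiv (ι × Fin n) (Fin n) _ K))

variable {K n} {ι : Type*} [Fintype ι] [DecidableEq ι]

theorem one_mem_commutatorLieAlgebra_of_ne (hn : (n : K) ≠ 1) :
    (1 : Matrix ι ι (LeavittAlgebra K n)) ∈ commutatorLieAlgebra K _ := by
  have h : ∑ i : Fin n, (Matrix.scalar ι (x K i) * Matrix.scalar ι (y K i) -
      Matrix.scalar ι (y K i) * Matrix.scalar ι (x K i)) =
      (1 - (n : K)) • (1 : Matrix ι ι (LeavittAlgebra K n)) := by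
    simp only [← map_mul, y_mul_x_self]
    rw [Finset.sum_sub_distrib, ← map_sum, sum_x_mul_y, map_one]
    simp [sub_smul, Nat.cast_smul_eq_nsmul]
  have hmem : (1 - (n : K)) • (1 : Matrix ι ι (LeavittAlgebra K n)) ∈
      (commutatorLieAlgebra K (Matrix ι ι (LeavittAlgebra K n))).toSubmodule := by
    rw [← h]
    exact Submodule.sum_mem _ fun i _ => commutator_mem_commutatorLieAlgebra _ _
  exact (Submodule.smul_mem_iff _ (sub_ne_zero.2 hn.symm)).1 hmem

/-- The trace separates `1` from `0`. -/
theorem nontrivial_of_natCast_eq_one (hn : (n : K) = 1) : Nontrivial (LeavittAlgebra K n) := by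
  refine ⟨1, 0, fun h => ?_⟩
  have h1 := trace_one K hn
  rw [h, map_zero] at h1
  exact zero_ne_one (Filter.Germ.const_inj.1 h1)

/-- The Lie algebra `[M_ι(L_K(n)), M_ι(L_K(n))]` is simple if `n = 1` in `K` and the size of the
matrices is nonzero in `K`. -/
theorem commutatorLieAlgebra_isSimple (hn2 : 2 ≤ n) (hn : (n : K) = 1)
    (hι : (Fintype.card ι : K) ≠ 0) :
    LieAlgebra.IsSimple K (commutatorLieAlgebra K (Matrix ι ι (LeavittAlgebra K n))) := by
  have := nontrivial_of_natCast_eq_one hn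
  have hpos : 1 ≤ Fintype.card ι := by
    rw [Nat.one_le_iff_ne_zero]
    intro h
    simp [h] at hι
  refine commutatorLieAlgebra_isSimple_of_algEquiv (matrixAlgEquiv K n ι)
    (Matrix.commutatorLieAlgebra_isSimple ?_ (fun s hs => exists_mul_mul_eq_one hn2 hs)
      (fun c hc => exists_algebraMap_eq_of_forall_commute hn2 hc)
      fun k hk => eq_zero_of_algebraMap_mem_commutator K hn ?_ hk)
  -- One enlargement would give only size `2` when `n = 2` and `ι` is a singleton; two give at least
  -- `4`.
  · simp only [Fintype.card_prod, Fintype.card_fin]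
    nlinarith [Nat.mul_le_mul hpos hn2]
  -- Since `n = 1` in `K`, the enlargement does not change the size as an element of `K`.
  · simpa [hn] using hι

end LeavittAlgebra

/-- If the size of the matrices is zero in `K`, then the identity matrix is a sum of
commutators. -/
theorem Matrix.one_mem_commutatorLieAlgebra_of_card_eq_zero {K S ι : Type*} [Field K] [Ring S]
    [Algebra K S] [Fintype ι] [DecidableEq ι] [Nonempty ι] (hι : (Fintype.card ι : K) = 0) :
    (1 : Matrix ι ι S) ∈ commutatorLieAlgebra K _ := by
  obtain ⟨j⟩ := ‹Nonempty ι›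
  have h : (1 : Matrix ι ι S) = ∑ i, (single i j (1 : S) * single j i 1 -
      single j i 1 * single i j 1) := by
    simp only [single_mul_single_same, mul_one]
    rw [Finset.sum_sub_distrib, sum_single_one, Finset.sum_const, Finset.card_univ,
      ← Nat.cast_smul_eq_nsmul K, hι, zero_smul, sub_zero]
  rw [h]
  exact Submodule.sum_mem (commutatorLieAlgebra K (Matrix ι ι S)).toSubmodule
    fun i _ => commutator_mem_commutatorLieAlgebra _ _

theorem corollary3p11 (K : Type*) [Field K] (n d : ℕ) (hn : 2 ≤ n) (hd : 1 ≤ d) :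
    LieAlgebra.IsSimple K
        (commutatorLieAlgebra K (Matrix (Fin d) (Fin d) (LeavittAlgebra K n))) ↔
      ringChar K ∣ n - 1 ∧ ¬ ringChar K ∣ d := by
  have hn1 : ringChar K ∣ n - 1 ↔ (n : K) = 1 := by
    rw [← ringChar.spec, Nat.cast_sub (by omega), Nat.cast_one, sub_eq_zero]
  rw [hn1, ← ringChar.spec]
  constructor
  · intro h
    refine ⟨?_, ?_⟩
    · by_contra hne
      exact not_isSimple_of_one_mem (LeavittAlgebra.one_mem_commutatorLieAlgebra_of_ne hne) h
    · intro hd0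
      have : Nonempty (Fin d) := ⟨⟨0, hd⟩⟩
      exact not_isSimple_of_one_mem
        (Matrix.one_mem_commutatorLieAlgebra_of_card_eq_zero (by simpa using hd0)) h
  · rintro ⟨h1, h2⟩
    exact LeavittAlgebra.commutatorLieAlgebra_isSimple hn h1 (by simpa using h2)
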